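/- Let $N\ge 0$ and let $D=D_0\setminus\bigcup_{i=1}^N \overline{D_i}\subset\mathbb R^2$, where $D_0,\dots,D_N$ are simply connected bounded domains with smooth boundaries $\Gamma_0,\dots,\Gamma_N$, the closures $\overline{D_1},\dots,\overline{D_N}$ are pairwise disjoint, and $\overline{D_i}\subset D_0$ for $1\le i\le N$. For $1\le i\le N$ let $\zeta_i$ be the solution of $\Delta\zeta_i=0$ in $D$, $\zeta_i=1$ on $\Gamma_i$, $\zeta_i=0$ on $\Gamma_j$ for $0\le j\le N$, $j\ne i$. Put $p_{ij}=\int_D\nabla\zeta_i\cdot\nabla\zeta_j\,dx$ and $(q_{ij})=(p_{ij})^{-1}$. For $\phi\in L^2(D)$ let $\mathcal G\phi\in H^1_0(D)$ be the solution of $-\Delta\mathcal G\phi=\phi$ in $D$, and $$\mathcal P\phi=\mathcal G\phi+\sum_{i,j=1}^N q_{ij}\Big(\int_D\zeta_i\phi\,dx\Big)\zeta_j .$$ Let $$\mathcal X=\Big\{u\in H^1(D)\ :\ u=v+\sum_{i=1}^N\theta_i\zeta_i,\ v\in H^1_0(D),\ \theta_1,\dots,\theta_N\in\mathbb R\Big\},$$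 $$\lambda=\inf\Big\{\int_D|\nabla u|^2dx\ :\ u\in\mathcal X,\ \|u\|_{L^2(D)}=1\Big\},\qquad \Lambda=\sup\Big\{\int_D\phi\,\mathcal P\phi\,dx\ :\ \phi\in L^2(D),\ \|\phi\|_{L^2(D)}=1\Big\}.$$ Then: (i) $\lambda\Lambda=1$; (ii) if $\tilde\phi$ is a maximizer for $\Lambda$ (that is, $\|\tilde\phi\|_{L^2(D)}=1$ and the supremum is attained at $\tilde\phi$), then $\Lambda^{-1}\mathcal P\tilde\phi$ is a minimizer for $\lambda$; (iii) if $\tilde u$ is a minimizer for $\lambda$ (that is, $\tilde u\in\mathcal X$, $\|\tilde u\|_{L^2(D)}=1$ and the infimum is attained at $\tilde u$), then $\Delta\tilde u\in L^2(D)$ in the sense of distributions, and $\lambda^{-1}(-\Delta\tilde u)$ is a maximizer for $\Lambda$. -/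

import Mathlib

open MeasureTheory Filter Topology
open scoped ContDiff ENNReal Distributions

noncomputable section

namespace HoledDomain

/-- The Euclidean plane. -/
abbrev Plane : Type := EuclideanSpace ℝ (Fin 2)

/-- `Ω` has a smooth boundary: near every boundary point, `Ω` is the sublevel set `{ρ < 0}` of a
smooth function `ρ` whose differential does not vanish at that point. -/
def HasSmoothBoundary (Ω : Set Plane) : Prop :=
  ∀ p ∈ frontier Ω, ∃ (U : Set Plane) (ρ : Plane → ℝ), IsOpen U ∧ p ∈ U ∧
    ContDiffOn ℝ ∞ ρ U ∧ fderiv ℝ ρ p ≠ 0 ∧ Ω ∩ U = {x ∈ U | ρ x < 0}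

/-- A simply connected bounded planar domain with a smooth boundary. (Simple connectedness includes
non-emptiness and path-connectedness.) -/
structure IsSmoothSimplyConnectedDomain (Ω : Set Plane) : Prop where
  isOpen : IsOpen Ω
  isBounded : Bornology.IsBounded Ω
  simplyConnected : IsSimplyConnected Ω
  smoothBoundary : HasSmoothBoundary Ω

/-! ### Sobolev notions on an open subset of the plane -/

section Sobolev

variable (D : TopologicalSpace.Opens Plane)

/-- Lebesgue measure on `D`. -/
abbrev vol : Measure Plane := volume.restrict (D : Set Plane)

/-- The space `L²(D)` of real functions. -/
abbrev L2 : Type := Lp ℝ 2 (vol D)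

/-- The space `L²(D; ℝ²)` of vector fields. -/
abbrev L2Vec : Type := Lp Plane 2 (vol D)

/-- `g` is the weak gradient of `u`: `∫ u ∇ψ = - ∫ ψ g` for every test function `ψ ∈ C_c^∞(D)`. -/
def HasWeakGradient (u : L2 D) (g : L2Vec D) : Prop :=
  ∀ ψ : 𝓓(D, ℝ), ∫ x, u x • gradient ψ x ∂(vol D) = - ∫ x, ψ x • g x ∂(vol D)

/-- `f` is the Laplacian of `u` in the sense of distributions on `D`: `∫ u Δψ = ∫ f ψ` for every
test function `ψ ∈ C_c^∞(D)`. -/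
def HasWeakLaplacian (u f : L2 D) : Prop :=
  ∀ ψ : 𝓓(D, ℝ),
    ∫ x, u x * Laplacian.laplacian (ψ : Plane → ℝ) x ∂(vol D) = ∫ x, f x * ψ x ∂(vol D)

/-- The Sobolev space `H¹(D)`, as a subset of `L²(D)`. -/
def H1 : Set (L2 D) := {u | ∃ g : L2Vec D, HasWeakGradient D u g}

/-- The weak gradient of `u ∈ H¹(D)` (it is unique; arbitrary if `u ∉ H¹(D)`). -/
def weakGradient (u : L2 D) : L2Vec D := Classical.epsilon (HasWeakGradient D u)

/-- The Sobolev space `H¹₀(D)`: the closure of `C_c^∞(D)` in `H¹(D)`. -/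
def H10 : Set (L2 D) :=
  {v | ∃ g : L2Vec D, HasWeakGradient D v g ∧ ∃ ψ : ℕ → 𝓓(D, ℝ),
    Tendsto (fun n => eLpNorm (fun x => v x - ψ n x) 2 (vol D)) atTop (𝓝 0) ∧
    Tendsto (fun n => eLpNorm (fun x => g x - gradient (ψ n) x) 2 (vol D)) atTop (𝓝 0)}

/-- The Dirichlet energy `∫_D |∇u|²`. -/
def dirichletEnergy (u : L2 D) : ℝ := ∫ x, ‖weakGradient D u x‖ ^ 2 ∂(vol D)

/-- The Green operator: `green D φ` is the solution `w ∈ H¹₀(D)` of `-Δw = φ`. -/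
def green (φ : L2 D) : L2 D :=
  Classical.epsilon fun w => w ∈ H10 D ∧ HasWeakLaplacian D w (-φ)

end Sobolev

/-- The data of a bounded domain with `N` holes: a simply connected bounded smooth domain `outer`
and `N` simply connected bounded smooth domains `hole i` with pairwise disjoint closures contained
in `outer`. -/
structure MultiplyConnected (N : ℕ) where
  outer : Set Plane
  hole : Fin N → Set Plane
  outer_smooth : IsSmoothSimplyConnectedDomain outer
  hole_smooth : ∀ i, IsSmoothSimplyConnectedDomain (hole i)
  hole_subset : ∀ i, closure (hole i) ⊆ outer
  hole_disjoint : ∀ i j, i ≠ j → Disjoint (closure (hole i)) (closure (hole j))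

namespace MultiplyConnected

variable {N : ℕ} (M : MultiplyConnected N)

/-- The domain `D`: the outer domain with the closed holes removed. Its boundary consists of
`Γ₀ = frontier outer` and `Γᵢ = frontier (hole i)`. -/
def domain : TopologicalSpace.Opens Plane :=
  ⟨M.outer \ ⋃ i, closure (M.hole i),
    M.outer_smooth.isOpen.sdiff (isClosed_iUnion_of_finite fun _ => isClosed_closure)⟩

/-- `ζ ∈ H¹(D)` is the harmonic function with boundary values `1` on `Γᵢ` and `0` on the other
boundary components: `Δζ = 0` in `D`, and `ζ - χ ∈ H¹₀(D)` for a smooth function `χ` that equals `1`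
near `Γᵢ` and `0` near `Γ₀` and near `Γⱼ`, `j ≠ i`. -/
def IsHarmonicPotential (i : Fin N) (ζ : L2 M.domain) : Prop :=
  ζ ∈ H1 M.domain ∧ HasWeakLaplacian M.domain ζ 0 ∧
    ∃ χ : Plane → ℝ, ContDiff ℝ ∞ χ ∧
      (∀ᶠ x in 𝓝ˢ (frontier M.outer), χ x = 0) ∧
      (∀ j, ∀ᶠ x in 𝓝ˢ (frontier (M.hole j)), χ x = if j = i then 1 else 0) ∧
      ∃ v ∈ H10 M.domain, ∀ᵐ x ∂(vol M.domain), ζ x = v x + χ x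

/-- The harmonic function `ζᵢ` with `ζᵢ = δᵢⱼ` on `Γⱼ` for `j = 0, …, N`. -/
def zeta (i : Fin N) : L2 M.domain := Classical.epsilon (M.IsHarmonicPotential i)

/-- The matrix `pᵢⱼ = ∫_D ∇ζᵢ · ∇ζⱼ`. -/
def p : Matrix (Fin N) (Fin N) ℝ := Matrix.of fun i j =>
  ∫ x, inner ℝ (weakGradient M.domain (M.zeta i) x) (weakGradient M.domain (M.zeta j) x)
    ∂(vol M.domain)

/-- The inverse matrix `q = p⁻¹`. -/
def q : Matrix (Fin N) (Fin N) ℝ := M.p⁻¹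

/-- The operator `𝒫φ = 𝒢φ + ∑ᵢⱼ qᵢⱼ (∫_D ζᵢ φ) ζⱼ`. -/
def opP (φ : L2 M.domain) : L2 M.domain :=
  green M.domain φ +
    ∑ i, ∑ j, (M.q i j * ∫ x, M.zeta i x * φ x ∂(vol M.domain)) • M.zeta j

/-- The space `𝒳` of all `u ∈ H¹(D)` of the form `u = v + ∑ᵢ θᵢ ζᵢ`, `v ∈ H¹₀(D)`, `θᵢ ∈ ℝ`. -/
def spaceX : Set (L2 M.domain) :=
  {u | u ∈ H1 M.domain ∧
    ∃ v ∈ H10 M.domain, ∃ θ : Fin N → ℝ, u = v + ∑ i, θ i • M.zeta i}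

/-- `λ = inf {∫_D |∇u|² : u ∈ 𝒳, ‖u‖ = 1}`. -/
def lam : ℝ :=
  sInf {e | ∃ u ∈ M.spaceX, ‖u‖ = 1 ∧ e = dirichletEnergy M.domain u}

/-- The quadratic form `∫_D φ 𝒫φ`. -/
def formP (φ : L2 M.domain) : ℝ := ∫ x, φ x * M.opP φ x ∂(vol M.domain)

/-- `Λ = sup {∫_D φ 𝒫φ : φ ∈ L²(D), ‖φ‖ = 1}`. -/
def Lam : ℝ := sSup {e | ∃ φ : L2 M.domain, ‖φ‖ = 1 ∧ e = M.formP φ}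

/-- `u` is a minimizer for `λ`. -/
def IsMinimizer (u : L2 M.domain) : Prop :=
  u ∈ M.spaceX ∧ ‖u‖ = 1 ∧ dirichletEnergy M.domain u = M.lam

/-- `φ` is a maximizer for `Λ`. -/
def IsMaximizer (φ : L2 M.domain) : Prop :=
  ‖φ‖ = 1 ∧ M.formP φ = M.Lam

end MultiplyConnected

end HoledDomain

end

/-!
Identify `u ∈ 𝒳` with the pair `(u, ∇u)`. The pairs form a subspace `X` of `L²(D) × L²(D; ℝ²)` on
which the Poincaré inequality `‖u‖ ≤ C ‖∇u‖` holds, and `𝒫φ` is the solution in `𝒳` of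
`∫ ∇𝒫φ · ∇v = ∫ φ v` for all `v ∈ 𝒳`: the functions `ζᵢ` are harmonic, so `∇ζᵢ` is orthogonal to the
gradients of `H¹₀(D)`, and the coefficients of `ζⱼ` in `𝒫φ` solve the remaining linear system, whose
matrix `p` is the Gram matrix of the linearly independent `∇ζᵢ`. Testing with `v = 𝒫φ` gives
`∫ φ 𝒫φ = ‖∇𝒫φ‖² ≤ λ⁻¹ ‖φ‖²`, and `1 = ‖u‖² = ∫ ∇𝒫u · ∇u ≤ ‖∇𝒫u‖ ‖∇u‖ ≤ Λ^(1/2) ‖∇u‖` for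
normalized `u ∈ 𝒳`; hence `λ Λ = 1`, and the two extremal problems correspond through the equality
cases of these inequalities.
-/

noncomputable section

namespace HoledDomain

section Duality

variable {E V : Type*} [NormedAddCommGroup E] [InnerProductSpace ℝ E]
  [NormedAddCommGroup V] [InnerProductSpace ℝ V] {X Y : Submodule ℝ (WithLp 2 (E × V))}

/-- The Poincaré inequality `‖u‖ ≤ C ‖∇u‖` on a space `X` of pairs `(u, ∇u)`. -/
def HasPoincare (X : Submodule ℝ (WithLp 2 (E × V))) : Prop :=
  ∃ C : ℝ, ∀ z ∈ X, ‖z.fst‖ ≤ C * ‖z.snd‖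

/-- `s = (w, ∇w)` solves the Dirichlet problem `-Δw = φ` in the weak sense, tested against the space
`X` of pairs `(u, ∇u)`. -/
def IsWeakSolution (X : Submodule ℝ (WithLp 2 (E × V))) (φ : E) (s : WithLp 2 (E × V)) : Prop :=
  s ∈ X ∧ ∀ z ∈ X, inner ℝ s.snd z.snd = inner ℝ φ z.fst

/-- `P` sends every `φ` to a weak solution of `-Δw = φ` in `X`. -/
def IsSolutionOperator (X : Submodule ℝ (WithLp 2 (E × V))) (P : E → E) : Prop :=
  ∀ φ, ∃ s, IsWeakSolution X φ s ∧ s.fst = P φ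

/-- The infimum of `‖∇u‖²` over the normalized pairs `(u, ∇u)` of `X`. -/
def rayleighInf (X : Submodule ℝ (WithLp 2 (E × V))) : ℝ :=
  sInf {e | ∃ z ∈ X, ‖z.fst‖ = 1 ∧ e = ‖z.snd‖ ^ 2}

/-- The supremum of the quadratic form of `P` over the unit sphere. -/
def formSup (P : E → E) : ℝ :=
  sSup {e | ∃ φ : E, ‖φ‖ = 1 ∧ e = inner ℝ (P φ) φ}

/-- `z = (u, ∇u)` is a minimizer for `rayleighInf X`. -/
def IsRayleighMinimizer (X : Submodule ℝ (WithLp 2 (E × V))) (z : WithLp 2 (E × V)) : Prop :=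
  z ∈ X ∧ ‖z.fst‖ = 1 ∧ ‖z.snd‖ ^ 2 = rayleighInf X

/-- `φ` is a maximizer for `formSup P`. -/
def IsFormMaximizer (P : E → E) (φ : E) : Prop :=
  ‖φ‖ = 1 ∧ inner ℝ (P φ) φ = formSup P

theorem inner_snd_eq_iff_mem_orthogonal {φ : E} {g : V} {z : WithLp 2 (E × V)} :
    inner ℝ g z.snd = inner ℝ φ z.fst ↔ z ∈ (ℝ ∙ WithLp.toLp 2 (-φ, g))ᗮ := by
  rw [Submodule.mem_orthogonal_singleton_iff_inner_right, WithLp.prod_inner_apply]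
  change _ ↔ inner ℝ (-φ) z.fst + inner ℝ g z.snd = 0
  rw [inner_neg_left, neg_add_eq_zero, eq_comm]

theorem HasPoincare.exists_inner_snd_eq (hX : HasPoincare X) [CompleteSpace X]
    (r : WithLp 2 (E × V)) : ∃ s ∈ X, ∀ z ∈ X, inner ℝ s.snd z.snd = inner ℝ r z := by
  obtain ⟨C, hC⟩ := hX
  let G : X →L[ℝ] V := (WithLp.sndL 2 ℝ E V).comp X.subtypeL
  let B : X →L[ℝ] X →L[ℝ] ℝ := (innerSL ℝ).bilinearComp G G
  have coercive : IsCoercive B := by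
    refine ⟨(1 + C ^ 2)⁻¹, by positivity, fun z => ?_⟩
    have poincare_sq : ‖z.1.fst‖ ^ 2 ≤ (C * ‖z.1.snd‖) ^ 2 := by
      gcongr
      exact hC z.1 z.2
    change _ ≤ inner ℝ z.1.snd z.1.snd
    rw [real_inner_self_eq_norm_sq, mul_assoc, ← sq, inv_mul_le_iff₀ (by positivity),
      Submodule.coe_norm, WithLp.prod_norm_sq_eq_of_L2]
    linarith
  let s := coercive.continuousLinearEquivOfBilin.symm (X.orthogonalProjectionOnto r)
  refine ⟨s, s.2, fun z hz => ?_⟩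
  have riesz : inner ℝ (coercive.continuousLinearEquivOfBilin s) ⟨z, hz⟩ = inner ℝ s.1.snd z.snd :=
    coercive.continuousLinearEquivOfBilin_apply s ⟨z, hz⟩
  rw [← riesz, ContinuousLinearEquiv.apply_symm_apply,
    Submodule.inner_orthogonalProjectionOnto_eq_of_mem_right]

theorem hasPoincare_of_finiteDimensional [FiniteDimensional ℝ X]
    (hX : ∀ z ∈ X, z.snd = 0 → z = 0) : HasPoincare X := by
  let G : X →ₗ[ℝ] V := (WithLp.sndₗ 2 ℝ E V) ∘ₗ X.subtype
  have hG : LinearMap.ker G = ⊥ :=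
    LinearMap.ker_eq_bot'.2 fun z hz => Subtype.ext (hX z z.2 hz)
  obtain ⟨K, -, hK⟩ := G.exists_antilipschitzWith hG
  refine ⟨K, fun z hz => ?_⟩
  calc ‖z.fst‖ ≤ ‖z‖ := WithLp.norm_fst_le E z
    _ ≤ K * ‖z.snd‖ := hK.le_mul_norm (map_zero G) ⟨z, hz⟩

theorem hasPoincare_span_range {ι : Type*} [Finite ι] {ζ : ι → WithLp 2 (E × V)}
    (hζ : LinearIndependent ℝ fun i => (ζ i).snd) : HasPoincare (.span ℝ (Set.range ζ)) := by
  have := Fintype.ofFinite ι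
  have := FiniteDimensional.span_of_finite ℝ (Set.finite_range ζ)
  refine hasPoincare_of_finiteDimensional fun z hz hz0 => ?_
  obtain ⟨θ, rfl⟩ := (Submodule.mem_span_range_iff_exists_fun ℝ).1 hz
  have hθ : ∑ i, θ i • (ζ i).snd = 0 := by
    simpa only [map_smul, WithLp.sndₗ_apply] using
      (map_sum (WithLp.sndₗ 2 ℝ E V) _ _).symm.trans hz0
  simp only [Fintype.linearIndependent_iff.1 hζ θ hθ, zero_smul, Finset.sum_const_zero]

theorem HasPoincare.sup (hX : HasPoincare X) (hY : HasPoincare Y)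
    (h : ∀ x ∈ X, ∀ y ∈ Y, inner ℝ x.snd y.snd = 0) : HasPoincare (X ⊔ Y) := by
  obtain ⟨C, hC⟩ := hX
  obtain ⟨K, hK⟩ := hY
  refine ⟨|C| + |K|, fun z hz => ?_⟩
  obtain ⟨x, hx, y, hy, rfl⟩ := Submodule.mem_sup.1 hz
  have pythagoras := norm_add_sq_eq_norm_sq_add_norm_sq_real (h x hx y hy)
  have hx_le : ‖x.snd‖ ≤ ‖x.snd + y.snd‖ := by
    nlinarith [norm_nonneg x.snd, norm_nonneg (x.snd + y.snd), mul_self_nonneg ‖y.snd‖]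
  have hy_le : ‖y.snd‖ ≤ ‖x.snd + y.snd‖ := by
    nlinarith [norm_nonneg y.snd, norm_nonneg (x.snd + y.snd), mul_self_nonneg ‖x.snd‖]
  calc ‖x.fst + y.fst‖ ≤ ‖x.fst‖ + ‖y.fst‖ := norm_add_le _ _
    _ ≤ C * ‖x.snd‖ + K * ‖y.snd‖ := add_le_add (hC x hx) (hK y hy)
    _ ≤ |C| * ‖x.snd + y.snd‖ + |K| * ‖x.snd + y.snd‖ := by
      gcongr <;> exact le_abs_self _
    _ = (|C| + |K|) * ‖x.snd + y.snd‖ := (add_mul _ _ _).symm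

theorem inner_sum_gram_inv_smul {ι : Type*} [Fintype ι] [DecidableEq ι] {b : ι → V}
    (hb : LinearIndependent ℝ b) (a : ι → ℝ) (k : ι) :
    inner ℝ (∑ i, ∑ j, ((Matrix.gram ℝ b)⁻¹ i j * a i) • b j) (b k) = a k := by
  have gram_inv_mul : (Matrix.gram ℝ b)⁻¹ * Matrix.gram ℝ b = 1 :=
    Matrix.nonsing_inv_mul _ (Matrix.det_gram_ne_zero_iff_linearIndependent.2 hb).isUnit
  calc inner ℝ (∑ i, ∑ j, ((Matrix.gram ℝ b)⁻¹ i j * a i) • b j) (b k)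
      = ∑ i, a i * ((Matrix.gram ℝ b)⁻¹ * Matrix.gram ℝ b) i k := by
        simp only [sum_inner, real_inner_smul_left, Matrix.mul_apply, Matrix.gram_apply,
          Finset.mul_sum]
        exact Finset.sum_congr rfl fun i _ => Finset.sum_congr rfl fun j _ => by ring
    _ = a k := by
        simp only [gram_inv_mul, Matrix.one_apply, mul_ite, mul_one, mul_zero,
          Finset.sum_ite_eq', Finset.mem_univ, if_true]

theorem IsWeakSolution.add_sum_gram_inv_smul {ι : Type*} [Fintype ι] [DecidableEq ι]
    {ζ : ι → WithLp 2 (E × V)} (hζ : LinearIndependent ℝ fun i => (ζ i).snd)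
    (horth : ∀ z ∈ X, ∀ i, inner ℝ (ζ i).snd z.snd = 0) {φ : E} {s : WithLp 2 (E × V)}
    (hs : IsWeakSolution X φ s) :
    IsWeakSolution (X ⊔ .span ℝ (Set.range ζ)) φ
      (s + ∑ i, ∑ j, ((Matrix.gram ℝ fun i => (ζ i).snd)⁻¹ i j * inner ℝ φ (ζ i).fst) • ζ j) := by
  set c := ∑ i, ∑ j, ((Matrix.gram ℝ fun i => (ζ i).snd)⁻¹ i j * inner ℝ φ (ζ i).fst) • ζ j
    with hc
  have c_snd : c.snd =
      ∑ i, ∑ j, ((Matrix.gram ℝ fun i => (ζ i).snd)⁻¹ i j * inner ℝ φ (ζ i).fst) • (ζ j).snd := by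
    rw [← WithLp.sndₗ_apply (𝕜 := ℝ)]
    simp only [hc, map_sum, map_smul, WithLp.sndₗ_apply]
  have hcX : c ∈ Submodule.span ℝ (Set.range ζ) := sum_mem fun i _ => sum_mem fun j _ =>
    Submodule.smul_mem _ _ (Submodule.subset_span ⟨j, rfl⟩)
  suffices h : X ⊔ .span ℝ (Set.range ζ) ≤ (ℝ ∙ WithLp.toLp 2 (-φ, s.snd + c.snd))ᗮ from
    ⟨Submodule.add_mem_sup hs.1 hcX, fun z hz => inner_snd_eq_iff_mem_orthogonal.2 (h hz)⟩
  refine sup_le (fun z hz => inner_snd_eq_iff_mem_orthogonal.1 ?_) (Submodule.span_le.2 ?_)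
  · have c_orth : inner ℝ c.snd z.snd = 0 := by
      simp only [c_snd, sum_inner, real_inner_smul_left, horth z hz, mul_zero,
        Finset.sum_const_zero]
    rw [inner_add_left, hs.2 z hz, c_orth, add_zero]
  · rintro _ ⟨k, rfl⟩
    refine inner_snd_eq_iff_mem_orthogonal.1 ?_
    rw [inner_add_left, real_inner_comm, horth s hs.1, zero_add, c_snd,
      inner_sum_gram_inv_smul hζ]

theorem rayleighInf_mul_le {z : WithLp 2 (E × V)} (hz : z ∈ X) :
    rayleighInf X * ‖z.fst‖ ^ 2 ≤ ‖z.snd‖ ^ 2 := by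
  rcases eq_or_ne z.fst 0 with h0 | h0
  · rw [h0, norm_zero, zero_pow two_ne_zero, mul_zero]
    positivity
  · have normalized : ‖(‖z.fst‖⁻¹ • z).fst‖ = 1 := norm_smul_inv_norm h0
    have le : rayleighInf X ≤ ‖(‖z.fst‖⁻¹ • z).snd‖ ^ 2 :=
      csInf_le ⟨0, by rintro _ ⟨w, -, -, rfl⟩; positivity⟩ ⟨_, X.smul_mem _ hz, normalized, rfl⟩
    rw [WithLp.smul_snd, norm_smul, norm_inv, norm_norm, ← div_eq_inv_mul, div_pow] at le
    exact (le_div_iff₀ (by positivity)).1 le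

theorem rayleighInf_pos (hX : HasPoincare X) (hne : ∃ z ∈ X, z.fst ≠ 0) : 0 < rayleighInf X := by
  obtain ⟨C, hC⟩ := hX
  obtain ⟨z, hz, hz0⟩ := hne
  have lower : ∀ w ∈ X, ‖w.fst‖ = 1 → (C ^ 2)⁻¹ ≤ ‖w.snd‖ ^ 2 := fun w hw h1 => by
    have le : 1 ≤ C * ‖w.snd‖ := h1 ▸ hC w hw
    have hC0 : C ≠ 0 := fun h => by norm_num [h] at le
    rw [inv_le_iff_one_le_mul₀ (by positivity), ← mul_pow, mul_comm]
    exact one_le_pow₀ le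
  refine lt_of_lt_of_le (b := (C ^ 2)⁻¹) ?_ (le_csInf
    ⟨_, ‖z.fst‖⁻¹ • z, X.smul_mem _ hz, norm_smul_inv_norm hz0, rfl⟩ ?_)
  · have hC0 : C ≠ 0 := fun h => hz0 (by simpa [h] using hC z hz)
    positivity
  · rintro _ ⟨w, hw, h1, rfl⟩
    exact lower w hw h1

theorem IsWeakSolution.inner_fst_self {φ : E} {s : WithLp 2 (E × V)} (hs : IsWeakSolution X φ s) :
    inner ℝ s.fst φ = ‖s.snd‖ ^ 2 := by
  rw [real_inner_comm, ← hs.2 s hs.1, real_inner_self_eq_norm_sq]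

theorem IsWeakSolution.norm_snd_sq_le (hX : 0 < rayleighInf X) {φ : E} {s : WithLp 2 (E × V)}
    (hs : IsWeakSolution X φ s) : ‖s.snd‖ ^ 2 ≤ (rayleighInf X)⁻¹ * ‖φ‖ ^ 2 := by
  have energy_le : ‖s.snd‖ ^ 2 ≤ ‖s.fst‖ * ‖φ‖ :=
    hs.inner_fst_self ▸ real_inner_le_norm s.fst φ
  have rayleigh := rayleighInf_mul_le hs.1
  rw [← div_eq_inv_mul, le_div_iff₀ hX]
  -- With `r = rayleighInf X`: `2 r ‖w‖ ‖φ‖ ≤ (r ‖w‖)² + ‖φ‖²` and `r ‖w‖² ≤ ‖∇w‖² ≤ ‖w‖ ‖φ‖`.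
  nlinarith [sq_nonneg (rayleighInf X * ‖s.fst‖ - ‖φ‖),
    mul_le_mul_of_nonneg_left rayleigh hX.le, mul_le_mul_of_nonneg_left energy_le hX.le]

theorem IsSolutionOperator.inner_le (hX : 0 < rayleighInf X) {P : E → E}
    (hP : IsSolutionOperator X P) {φ : E} (hφ : ‖φ‖ = 1) :
    inner ℝ (P φ) φ ≤ (rayleighInf X)⁻¹ := by
  obtain ⟨s, hs, hsP⟩ := hP φ
  simpa only [← hsP, hs.inner_fst_self, hφ, one_pow, mul_one] using hs.norm_snd_sq_le hX

theorem IsSolutionOperator.inner_le_formSup (hX : 0 < rayleighInf X) {P : E → E}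
    (hP : IsSolutionOperator X P) {φ : E} (hφ : ‖φ‖ = 1) : inner ℝ (P φ) φ ≤ formSup P :=
  le_csSup ⟨(rayleighInf X)⁻¹, by rintro _ ⟨ψ, hψ, rfl⟩; exact hP.inner_le hX hψ⟩ ⟨φ, hφ, rfl⟩

theorem IsSolutionOperator.one_le_formSup_mul (hX : 0 < rayleighInf X) {P : E → E}
    (hP : IsSolutionOperator X P) {z : WithLp 2 (E × V)} (hz : z ∈ X) (h1 : ‖z.fst‖ = 1) :
    1 ≤ formSup P * ‖z.snd‖ ^ 2 := by
  obtain ⟨s, hs, hsP⟩ := hP z.fst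
  have pairing : 1 ≤ ‖s.snd‖ * ‖z.snd‖ := calc
    1 = inner ℝ s.snd z.snd := by rw [hs.2 z hz, real_inner_self_eq_norm_sq, h1, one_pow]
    _ ≤ ‖s.snd‖ * ‖z.snd‖ := real_inner_le_norm _ _
  calc 1 ≤ (‖s.snd‖ * ‖z.snd‖) ^ 2 := one_le_pow₀ pairing
    _ = inner ℝ (P z.fst) z.fst * ‖z.snd‖ ^ 2 := by rw [mul_pow, ← hsP, hs.inner_fst_self]
    _ ≤ formSup P * ‖z.snd‖ ^ 2 := by gcongr; exact hP.inner_le_formSup hX h1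

theorem IsSolutionOperator.rayleighInf_mul_formSup (hX : 0 < rayleighInf X) {P : E → E}
    (hP : IsSolutionOperator X P) (hne : ∃ z ∈ X, z.fst ≠ 0) :
    rayleighInf X * formSup P = 1 := by
  obtain ⟨z, hz, hz0⟩ := hne
  have hw : ‖z.fst‖⁻¹ • z ∈ X := X.smul_mem _ hz
  have hw1 : ‖(‖z.fst‖⁻¹ • z).fst‖ = 1 := norm_smul_inv_norm hz0
  have sup_pos : 0 < formSup P :=
    pos_of_mul_pos_left (one_pos.trans_le (hP.one_le_formSup_mul hX hw hw1)) (sq_nonneg _)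
  have sup_le : formSup P ≤ (rayleighInf X)⁻¹ :=
    csSup_le ⟨_, _, hw1, rfl⟩ (by rintro _ ⟨φ, hφ, rfl⟩; exact hP.inner_le hX hφ)
  have le_inf : (formSup P)⁻¹ ≤ rayleighInf X := le_csInf ⟨_, _, hw, hw1, rfl⟩ (by
    rintro _ ⟨v, hv, hv1, rfl⟩
    exact (inv_le_iff_one_le_mul₀' sup_pos).2 (hP.one_le_formSup_mul hX hv hv1))
  exact le_antisymm ((le_inv_mul_iff₀ hX).1 (by rwa [mul_one]))
    ((inv_le_iff_one_le_mul₀ sup_pos).1 le_inf)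

theorem IsFormMaximizer.exists_isRayleighMinimizer (hX : 0 < rayleighInf X) {P : E → E}
    (hP : IsSolutionOperator X P) (hPX : rayleighInf X * formSup P = 1) {φ : E}
    (hφ : IsFormMaximizer P φ) :
    ∃ z, IsRayleighMinimizer X z ∧ z.fst = (formSup P)⁻¹ • P φ := by
  obtain ⟨s, hs, hsP⟩ := hP φ
  have sup_eq : formSup P = (rayleighInf X)⁻¹ := eq_inv_of_mul_eq_one_right hPX
  have hmax : inner ℝ s.fst φ = (rayleighInf X)⁻¹ := by rw [hsP, hφ.2, sup_eq]
  have energy : ‖s.snd‖ ^ 2 = (rayleighInf X)⁻¹ := hs.inner_fst_self ▸ hmax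
  have norm_fst : ‖s.fst‖ = (rayleighInf X)⁻¹ := by
    refine le_antisymm ?_ ?_
    · have rayleigh := rayleighInf_mul_le hs.1
      rw [energy, ← le_inv_mul_iff₀ hX, ← sq] at rayleigh
      exact (sq_le_sq₀ (norm_nonneg _) (by positivity)).1 rayleigh
    · simpa only [hmax, hφ.1, mul_one] using real_inner_le_norm s.fst φ
  refine ⟨rayleighInf X • s, ⟨X.smul_mem _ hs.1, ?_, ?_⟩, ?_⟩
  · rw [WithLp.smul_fst, norm_smul, norm_fst, Real.norm_of_nonneg hX.le, mul_inv_cancel₀ hX.ne']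
  · rw [WithLp.smul_snd, norm_smul, mul_pow, energy, Real.norm_of_nonneg hX.le, sq,
      mul_inv_cancel_right₀ hX.ne']
  · rw [WithLp.smul_fst, hsP, sup_eq, inv_inv]

theorem IsRayleighMinimizer.snd_eq_smul (hX : 0 < rayleighInf X) {s z : WithLp 2 (E × V)}
    (hz : IsRayleighMinimizer X z) (hs : IsWeakSolution X z.fst s) :
    z.snd = rayleighInf X • s.snd := by
  have pairing : inner ℝ z.snd s.snd = 1 := by
    rw [real_inner_comm, hs.2 z hz.1, real_inner_self_eq_norm_sq, hz.2.1, one_pow]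
  have energy_le : ‖s.snd‖ ^ 2 ≤ (rayleighInf X)⁻¹ := by
    simpa only [hz.2.1, one_pow, mul_one] using hs.norm_snd_sq_le hX
  refine eq_of_norm_sub_eq_zero (pow_eq_zero_iff two_ne_zero |>.1 (le_antisymm ?_ (sq_nonneg _)))
  calc ‖z.snd - rayleighInf X • s.snd‖ ^ 2
      = rayleighInf X ^ 2 * ‖s.snd‖ ^ 2 - rayleighInf X := by
        rw [norm_sub_sq_real, real_inner_smul_right, pairing, hz.2.2, norm_smul, mul_pow,
          Real.norm_of_nonneg hX.le]
        ring
    _ ≤ rayleighInf X ^ 2 * (rayleighInf X)⁻¹ - rayleighInf X := by gcongr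
    _ = 0 := by rw [sq, mul_inv_cancel_right₀ hX.ne', sub_self]

theorem IsRayleighMinimizer.isWeakSolution (hX : 0 < rayleighInf X) {P : E → E}
    (hP : IsSolutionOperator X P) {z : WithLp 2 (E × V)} (hz : IsRayleighMinimizer X z) :
    IsWeakSolution X (rayleighInf X • z.fst) z := by
  obtain ⟨s, hs, -⟩ := hP z.fst
  refine ⟨hz.1, fun v hv => ?_⟩
  rw [hz.snd_eq_smul hX hs, real_inner_smul_left, hs.2 v hv, real_inner_smul_left]

theorem IsRayleighMinimizer.isFormMaximizer (hX : 0 < rayleighInf X) {P : E → E}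
    (hP : IsSolutionOperator X P) (hPX : rayleighInf X * formSup P = 1) {z : WithLp 2 (E × V)}
    (hz : IsRayleighMinimizer X z) : IsFormMaximizer P z.fst := by
  obtain ⟨s, hs, hsP⟩ := hP z.fst
  have pairing : inner ℝ s.snd z.snd = 1 := by
    rw [hs.2 z hz.1, real_inner_self_eq_norm_sq, hz.2.1, one_pow]
  rw [hz.snd_eq_smul hX hs, real_inner_smul_right, real_inner_self_eq_norm_sq] at pairing
  exact ⟨hz.2.1, mul_left_cancel₀ hX.ne' (by rw [← hsP, hs.inner_fst_self, pairing, hPX])⟩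

end Duality

section TestFunctions

variable {Ω D : TopologicalSpace.Opens Plane}

/-- The gradient of a test function, as a test vector field. -/
def testGradient : 𝓓(Ω, ℝ) →L[ℝ] 𝓓(Ω, Plane) :=
  let riesz : StrongDual ℝ Plane →L⋆[ℝ] Plane :=
    (InnerProductSpace.toDual ℝ Plane).symm.toContinuousLinearEquiv.toContinuousLinearMap
  (TestFunction.postcompCLM (𝕜 := ℝ) riesz).comp (TestFunction.fderivCLM ℝ ⊤ ⊤)

/-- The component `⟨e, F⟩` of a test vector field `F` in the direction `e`. -/
def testComponent (e : Plane) : 𝓓(Ω, Plane) →L[ℝ] 𝓓(Ω, ℝ) :=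
  TestFunction.postcompCLM (innerSL ℝ e)

/-- The test vector field `ψ e` of constant direction `e`. -/
def testField (e : Plane) : 𝓓(Ω, ℝ) →L[ℝ] 𝓓(Ω, Plane) :=
  TestFunction.postcompCLM (.toSpanSingleton ℝ e)

theorem coe_testGradient (ψ : 𝓓(Ω, ℝ)) : ⇑(testGradient ψ) = gradient ψ := by
  ext1 x
  change (InnerProductSpace.toDual ℝ Plane).symm (TestFunction.fderivCLM ℝ ⊤ ⊤ ψ x) = _
  rw [TestFunction.fderivCLM_apply_of_le ψ le_top, gradient]

theorem testComponent_apply (e : Plane) (Φ : 𝓓(Ω, Plane)) (x : Plane) :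
    testComponent e Φ x = inner ℝ e (Φ x) := rfl

theorem testField_apply (e : Plane) (ψ : 𝓓(Ω, ℝ)) (x : Plane) : testField e ψ x = ψ x • e := rfl

theorem testComponent_testGradient_apply (e : Plane) (ψ : 𝓓(Ω, ℝ)) (x : Plane) :
    testComponent e (testGradient ψ) x = fderiv ℝ ψ x e := by
  rw [testComponent_apply, coe_testGradient, real_inner_comm, inner_gradient_left]

theorem testComponent_testGradient_eq (e : Plane) (ψ : 𝓓(Ω, ℝ)) :
    ⇑(testComponent e (testGradient ψ)) = fun x => fderiv ℝ ψ x e :=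
  funext (testComponent_testGradient_apply e ψ)

/-- The standard orthonormal basis of the plane. -/
abbrev planeBasis : OrthonormalBasis (Fin 2) ℝ Plane := EuclideanSpace.basisFun (Fin 2) ℝ

/-- The divergence of a test vector field. -/
def testDivergence : 𝓓(Ω, Plane) →L[ℝ] 𝓓(Ω, ℝ) :=
  ∑ i, testComponent (planeBasis i) ∘L testGradient ∘L testComponent (planeBasis i)

theorem testDivergence_eq_sum (Φ : 𝓓(Ω, Plane)) : testDivergence Φ =
    ∑ i, testComponent (planeBasis i) (testGradient (testComponent (planeBasis i) Φ)) := by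
  simp only [testDivergence, sum_apply, ContinuousLinearMap.comp_apply]

theorem sum_testField_testComponent (Φ : 𝓓(Ω, Plane)) :
    ∑ i, testField (planeBasis i) (testComponent (planeBasis i) Φ) = Φ := by
  ext1 x
  rw [← planeBasis.sum_repr' (Φ x), Fin.sum_univ_two, Fin.sum_univ_two]
  rfl

theorem coe_testDivergence_testGradient (ψ : 𝓓(Ω, ℝ)) :
    ⇑(testDivergence (testGradient ψ)) = Laplacian.laplacian (ψ : Plane → ℝ) := by
  have second_derivative (e : Plane) (x : Plane) :
      testComponent e (testGradient (testComponent e (testGradient ψ))) x =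
        fderiv ℝ (fderiv ℝ ψ) x e e := by
    have differentiable : DifferentiableAt ℝ (fderiv ℝ ψ) x :=
      (ψ.contDiff.fderiv_right (m := 1) (by norm_cast)).differentiable one_ne_zero x
    rw [testComponent_testGradient_apply, testComponent_testGradient_eq,
      fderiv_clm_apply differentiable (differentiableAt_const e)]
    simp
  ext1 x
  simp only [InnerProductSpace.laplacian_eq_iteratedFDeriv_orthonormalBasis _ planeBasis,
    testDivergence_eq_sum, Fin.sum_univ_two, iteratedFDeriv_two_apply]
  exact congrArg₂ (· + ·) (second_derivative _ x) (second_derivative _ x)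

theorem memLp_testFunction {F : Type*} [NormedAddCommGroup F] [NormedSpace ℝ F] (Φ : 𝓓(Ω, F))
    (p : ℝ≥0∞) (μ : Measure Plane) [IsFiniteMeasureOnCompacts μ] : MemLp Φ p μ :=
  Φ.continuous.memLp_of_hasCompactSupport Φ.hasCompactSupport

variable (D) in
/-- The class in `L²(D; F)` of a test function on some open set `Ω`, not necessarily supported
in `D`. -/
def toL2 {F : Type*} [NormedAddCommGroup F] [NormedSpace ℝ F] : 𝓓(Ω, F) →ₗ[ℝ] Lp F 2 (vol D) where
  toFun Φ := (memLp_testFunction Φ 2 (vol D)).toLp Φ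
  map_add' _ _ := rfl
  map_smul' _ _ := rfl

theorem coeFn_toL2 {F : Type*} [NormedAddCommGroup F] [NormedSpace ℝ F] (Φ : 𝓓(Ω, F)) :
    toL2 D Φ =ᵐ[vol D] Φ :=
  (memLp_testFunction Φ 2 (vol D)).coeFn_toLp

theorem toL2_congr {Ω' : TopologicalSpace.Opens Plane} {F : Type*} [NormedAddCommGroup F]
    [NormedSpace ℝ F] {Φ : 𝓓(Ω, F)} {Ψ : 𝓓(Ω', F)} (h : (Φ : Plane → F) = Ψ) :
    toL2 D Φ = toL2 D Ψ :=
  MemLp.toLp_congr (memLp_testFunction Φ 2 _) (memLp_testFunction Ψ 2 _) (.of_eq h)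

section InnerProductSpace

variable {F : Type*} [NormedAddCommGroup F] [InnerProductSpace ℝ F]

theorem inner_toL2 (h : Lp F 2 (vol D)) (Φ : 𝓓(Ω, F)) :
    inner ℝ h (toL2 D Φ) = ∫ x, inner ℝ (h x) (Φ x) ∂(vol D) := by
  rw [L2.inner_def]
  refine integral_congr_ae ?_
  filter_upwards [coeFn_toL2 Φ] with x hx
  rw [hx]

theorem toL2_inner_toL2 {Ω' : TopologicalSpace.Opens Plane} (Φ : 𝓓(Ω, F)) (Ψ : 𝓓(Ω', F)) :
    inner ℝ (toL2 D Φ) (toL2 D Ψ) = ∫ x, inner ℝ (Φ x) (Ψ x) ∂(vol D) := by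
  rw [inner_toL2]
  refine integral_congr_ae ?_
  filter_upwards [coeFn_toL2 Φ] with x hx
  rw [hx]

end InnerProductSpace

theorem eqOn_zero_of_toL2_eq_zero {ψ : 𝓓(Ω, ℝ)} (h : toL2 D ψ = 0) :
    Set.EqOn ψ 0 (D : Set Plane) := by
  refine Measure.eqOn_open_of_ae_eq (μ := volume) ?_ D.isOpen
    ψ.continuous.continuousOn continuousOn_const
  exact (coeFn_toL2 ψ).symm.trans (h ▸ Lp.coeFn_zero ℝ 2 (vol D))

theorem hasWeakGradient_iff_forall_direction {u : L2 D} {g : L2Vec D} :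
    HasWeakGradient D u g ↔ ∀ (ψ : 𝓓(D, ℝ)) (e : Plane),
      inner ℝ u (toL2 D (testComponent e (testGradient ψ))) =
        -inner ℝ g (toL2 D (testField e ψ)) := by
  have pair_gradient : ∀ (ψ : 𝓓(D, ℝ)) (e : Plane),
      inner ℝ u (toL2 D (testComponent e (testGradient ψ))) =
        inner ℝ e (∫ x, u x • gradient ψ x ∂(vol D)) := fun ψ e => by
    have integrable : Integrable (fun x => u x • testGradient ψ x) (vol D) :=
      memLp_one_iff_integrable.1 (MemLp.smul (p := 2) (q := 2)
        (memLp_testFunction (testGradient ψ) 2 _) (Lp.memLp u))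
    rw [← coe_testGradient, ← integral_inner integrable, inner_toL2]
    simp only [testComponent_apply, inner_smul_right, Real.inner_apply]
  have pair_field : ∀ (ψ : 𝓓(D, ℝ)) (e : Plane),
      inner ℝ g (toL2 D (testField e ψ)) = inner ℝ e (∫ x, ψ x • g x ∂(vol D)) := fun ψ e => by
    have integrable : Integrable (fun x => ψ x • g x) (vol D) :=
      memLp_one_iff_integrable.1 (MemLp.smul (p := 2) (q := 2) (Lp.memLp g)
        (memLp_testFunction ψ 2 _))
    rw [← integral_inner integrable, inner_toL2]
    simp only [testField_apply, inner_smul_right, real_inner_comm]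
  simp only [pair_gradient, pair_field, ← inner_neg_right]
  exact forall_congr' fun ψ => ⟨fun h e => by rw [h], ext_inner_left ℝ⟩

theorem HasWeakGradient.inner_testDivergence {u : L2 D} {g : L2Vec D} (h : HasWeakGradient D u g)
    (Φ : 𝓓(D, Plane)) : inner ℝ u (toL2 D (testDivergence Φ)) = -inner ℝ g (toL2 D Φ) := by
  conv_rhs => rw [← sum_testField_testComponent Φ]
  simp only [testDivergence_eq_sum, map_sum, inner_sum, ← Finset.sum_neg_distrib,
    hasWeakGradient_iff_forall_direction.1 h]

theorem HasWeakGradient.hasWeakLaplacian_iff {u f : L2 D} {g : L2Vec D}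
    (h : HasWeakGradient D u g) : HasWeakLaplacian D u f ↔
      ∀ ψ : 𝓓(D, ℝ), inner ℝ g (toL2 D (testGradient ψ)) = inner ℝ (-f) (toL2 D ψ) := by
  refine forall_congr' fun ψ => ?_
  have green : ∫ x, u x * Laplacian.laplacian (ψ : Plane → ℝ) x ∂(vol D) =
      -inner ℝ g (toL2 D (testGradient ψ)) := by
    rw [← h.inner_testDivergence, inner_toL2, coe_testDivergence_testGradient]
    simp only [Real.inner_apply]
  have pair : ∫ x, f x * ψ x ∂(vol D) = inner ℝ f (toL2 D ψ) := by
    simp only [inner_toL2, Real.inner_apply]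
  rw [green, pair, inner_neg_left, neg_eq_iff_eq_neg]

theorem HasWeakGradient.unique {u : L2 D} {g g' : L2Vec D} (h : HasWeakGradient D u g)
    (h' : HasWeakGradient D u g') : g = g' := by
  have locally_integrable : LocallyIntegrableOn (fun x => g x - g' x) D volume :=
    locallyIntegrableOn_of_locallyIntegrable_restrict
      (((Lp.memLp g).sub (Lp.memLp g')).locallyIntegrable (by norm_num))
  have ae_zero := D.isOpen.ae_eq_zero_of_integral_contDiff_smul_eq_zero locally_integrable
    fun ψ hψ hψc hψD => by
      let Ψ : 𝓓(D, ℝ) := ⟨ψ, hψ, hψc, hψD⟩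
      have integrable (k : L2Vec D) : Integrable (fun x => ψ x • k x) (vol D) :=
        memLp_one_iff_integrable.1 (MemLp.smul (p := 2) (q := 2) (Lp.memLp k)
          (memLp_testFunction Ψ 2 _))
      have integral_eq : ∫ x, ψ x • g x ∂(vol D) = ∫ x, ψ x • g' x ∂(vol D) :=
        neg_injective ((h Ψ).symm.trans (h' Ψ))
      rw [← setIntegral_eq_integral_of_forall_compl_eq_zero (s := (D : Set Plane))]
      · simp only [smul_sub]
        rw [integral_sub (integrable g) (integrable g'), integral_eq, sub_self]
      · intro x hx
        rw [image_eq_zero_of_notMem_tsupport fun hx' => hx (hψD hx'), zero_smul]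
  refine Lp.ext ((ae_restrict_iff' D.isOpen.measurableSet).2 ?_)
  filter_upwards [ae_zero] with x hx hxD using sub_eq_zero.1 (hx hxD)

theorem HasWeakGradient.weakGradient_eq {u : L2 D} {g : L2Vec D} (h : HasWeakGradient D u g) :
    weakGradient D u = g :=
  HasWeakGradient.unique (Classical.epsilon_spec (p := HasWeakGradient D u) ⟨g, h⟩) h

theorem dirichletEnergy_eq_norm_sq (u : L2 D) : dirichletEnergy D u = ‖weakGradient D u‖ ^ 2 := by
  rw [← real_inner_self_eq_norm_sq, L2.inner_def]
  simp only [real_inner_self_eq_norm_sq, dirichletEnergy]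

variable (D) in
/-- The pairs `(u, ∇u)`, `u ∈ H¹(D)`. Since `∇u` is characterized by its pairings with the constant
multiples `ψ e` of test functions, they form an intersection of orthogonal complements. -/
def weakGradientGraph : Submodule ℝ (WithLp 2 (L2 D × L2Vec D)) :=
  ⨅ p : 𝓓(D, ℝ) × Plane, (ℝ ∙ WithLp.toLp 2
    (toL2 D (testComponent p.2 (testGradient p.1)), toL2 D (testField p.2 p.1)))ᗮ

theorem mem_weakGradientGraph {z : WithLp 2 (L2 D × L2Vec D)} :
    z ∈ weakGradientGraph D ↔ HasWeakGradient D z.fst z.snd := by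
  simp only [weakGradientGraph, Submodule.mem_iInf, Prod.forall,
    hasWeakGradient_iff_forall_direction, Submodule.mem_orthogonal_singleton_iff_inner_left,
    WithLp.prod_inner_apply, eq_neg_iff_add_eq_zero]
  rfl

theorem isClosed_weakGradientGraph :
    IsClosed (weakGradientGraph D : Set (WithLp 2 (L2 D × L2Vec D))) := by
  rw [weakGradientGraph, Submodule.coe_iInf]
  exact isClosed_iInter fun _ => Submodule.isClosed_orthogonal _

theorem hasWeakGradient_toL2 (χ : 𝓓(Ω, ℝ)) :
    HasWeakGradient D (toL2 D χ) (toL2 D (testGradient χ)) := by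
  refine hasWeakGradient_iff_forall_direction.2 fun ψ e => ?_
  have integral_domain (f : Plane → ℝ) (η : 𝓓(D, ℝ)) :
      ∫ x, f x * η x ∂(vol D) = ∫ x, f x * η x :=
    setIntegral_eq_integral_of_forall_compl_eq_zero fun x hx => by
      rw [image_eq_zero_of_notMem_tsupport fun hx' => hx (η.tsupport_subset hx'), mul_zero]
  have integrable (ξ : 𝓓(Ω, ℝ)) (η : 𝓓(D, ℝ)) : Integrable (fun x => ξ x * η x) volume :=
    (memLp_testFunction ξ 2 volume).integrable_mul (memLp_testFunction η 2 volume)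
  have by_parts : ∫ x, χ x * fderiv ℝ ψ x e = -∫ x, fderiv ℝ χ x e * ψ x := by
    refine integral_mul_fderiv_eq_neg_fderiv_mul_of_integrable ?_ ?_ (integrable χ ψ)
      (fun x _ => χ.contDiff.differentiable (by simp) x)
      (fun x _ => ψ.contDiff.differentiable (by simp) x)
    · simpa only [testComponent_testGradient_apply] using
        integrable (testComponent e (testGradient χ)) ψ
    · simpa only [testComponent_testGradient_apply] using
        integrable χ (testComponent e (testGradient ψ))
  calc inner ℝ (toL2 D χ) (toL2 D (testComponent e (testGradient ψ)))
      = ∫ x, χ x * testComponent e (testGradient ψ) x := by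
        rw [toL2_inner_toL2, ← integral_domain]
        simp only [Real.inner_apply]
    _ = -∫ x, testComponent e (testGradient χ) x * ψ x := by
        simpa only [testComponent_testGradient_apply] using by_parts
    _ = -inner ℝ (toL2 D (testGradient χ)) (toL2 D (testField e ψ)) := by
        rw [toL2_inner_toL2, ← integral_domain]
        simp only [testField_apply, testComponent_apply, real_inner_smul_right, real_inner_comm e,
          mul_comm]

variable (D) in
/-- The map `ψ ↦ (ψ, ∇ψ)` on test functions. -/
def jet : 𝓓(Ω, ℝ) →ₗ[ℝ] WithLp 2 (L2 D × L2Vec D) where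
  toFun ψ := WithLp.toLp 2 (toL2 D ψ, toL2 D (testGradient ψ))
  map_add' _ _ := by simp only [map_add]; rfl
  map_smul' _ _ := by simp only [map_smul]; rfl

theorem jet_mem_weakGradientGraph (χ : 𝓓(Ω, ℝ)) : jet D χ ∈ weakGradientGraph D :=
  mem_weakGradientGraph.2 (hasWeakGradient_toL2 χ)

end TestFunctions

section SobolevZero

variable {D : TopologicalSpace.Opens Plane}

variable (D) in
/-- The pairs `(v, ∇v)`, `v ∈ H¹₀(D)`. -/
def sobolevZero : Submodule ℝ (WithLp 2 (L2 D × L2Vec D)) :=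
  (LinearMap.range (jet D : 𝓓(D, ℝ) →ₗ[ℝ] _)).topologicalClosure

instance : CompleteSpace (sobolevZero D) :=
  (Submodule.isClosed_topologicalClosure _).completeSpace_coe

theorem jet_mem_sobolevZero (ψ : 𝓓(D, ℝ)) : jet D ψ ∈ sobolevZero D :=
  Submodule.le_topologicalClosure _ ⟨ψ, rfl⟩

theorem sobolevZero_subset {s : Set (WithLp 2 (L2 D × L2Vec D))} (hs : IsClosed s)
    (h : ∀ ψ : 𝓓(D, ℝ), jet D ψ ∈ s) : (sobolevZero D : Set (WithLp 2 (L2 D × L2Vec D))) ⊆ s :=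
  closure_minimal (Set.range_subset_iff.2 h) hs

theorem sobolevZero_le_weakGradientGraph : sobolevZero D ≤ weakGradientGraph D :=
  sobolevZero_subset isClosed_weakGradientGraph jet_mem_weakGradientGraph

theorem tendsto_toL2_iff {Ω : TopologicalSpace.Opens Plane} {F : Type*} [NormedAddCommGroup F]
    [NormedSpace ℝ F] {Φ : ℕ → 𝓓(Ω, F)} {h : Lp F 2 (vol D)} :
    Tendsto (fun n => toL2 D (Φ n)) atTop (𝓝 h) ↔
      Tendsto (fun n => eLpNorm (fun x => h x - Φ n x) 2 (vol D)) atTop (𝓝 0) := by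
  rw [Lp.tendsto_Lp_iff_tendsto_eLpNorm']
  refine tendsto_congr fun n => ?_
  rw [eLpNorm_sub_comm]
  refine eLpNorm_congr_ae ?_
  filter_upwards [coeFn_toL2 (Φ n)] with x hx
  rw [Pi.sub_apply, hx]

theorem mem_H10_iff {v : L2 D} : v ∈ H10 D ↔ ∃ z ∈ sobolevZero D, z.fst = v := by
  constructor
  · rintro ⟨g, -, ψ, hv, hg⟩
    simp only [← coe_testGradient] at hg
    refine ⟨.toLp 2 (v, g), mem_closure_of_tendsto (f := fun n => jet D (ψ n)) (b := atTop) ?_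
      (Eventually.of_forall fun n => ⟨ψ n, rfl⟩), rfl⟩
    exact ((WithLp.prodContinuousLinearEquiv 2 ℝ (L2 D) (L2Vec D)).symm.continuous.tendsto
      (v, g)).comp ((tendsto_toL2_iff.2 hv).prodMk_nhds (tendsto_toL2_iff.2 hg))
  · rintro ⟨z, hz, rfl⟩
    obtain ⟨j, hj, hlim⟩ := mem_closure_iff_seq_limit.1 hz
    choose ψ hψ using hj
    obtain rfl : (fun n => jet D (ψ n)) = j := funext hψ
    refine ⟨z.snd, mem_weakGradientGraph.1 (sobolevZero_le_weakGradientGraph hz), ψ,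
      tendsto_toL2_iff.1 (((WithLp.fstL 2 ℝ (L2 D) (L2Vec D)).continuous.tendsto z).comp hlim), ?_⟩
    simp only [← coe_testGradient]
    exact tendsto_toL2_iff.1
      (((WithLp.sndL 2 ℝ (L2 D) (L2Vec D)).continuous.tendsto z).comp hlim)

theorem HasWeakGradient.hasWeakLaplacian_iff_sobolevZero {u f : L2 D} {g : L2Vec D}
    (h : HasWeakGradient D u g) : HasWeakLaplacian D u f ↔
      ∀ z ∈ sobolevZero D, inner ℝ g z.snd = inner ℝ (-f) z.fst := by
  refine h.hasWeakLaplacian_iff.trans ⟨fun hf => ?_, fun hf ψ => hf _ (jet_mem_sobolevZero ψ)⟩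
  have le : sobolevZero D ≤ (ℝ ∙ WithLp.toLp 2 (- -f, g))ᗮ :=
    sobolevZero_subset (Submodule.isClosed_orthogonal _) fun ψ =>
      inner_snd_eq_iff_mem_orthogonal.1 (hf ψ)
  exact fun z hz => inner_snd_eq_iff_mem_orthogonal.2 (le hz)

end SobolevZero

section Poincare

variable {D : TopologicalSpace.Opens Plane}

variable (D) in
/-- The test functions on the plane whose gradient vanishes off `D`. -/
def flatOff : Submodule ℝ 𝓓((⊤ : TopologicalSpace.Opens Plane), ℝ) where
  carrier := {ψ | ∀ x ∉ D, testGradient ψ x = 0}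
  add_mem' {ψ χ} hψ hχ x hx := by
    rw [map_add, FunLike.coe_add, Pi.add_apply, hψ x hx, hχ x hx, add_zero]
  zero_mem' x _ := by rw [map_zero, FunLike.coe_zero, Pi.zero_apply]
  smul_mem' c ψ hψ x hx := by
    rw [map_smul, FunLike.coe_smul, Pi.smul_apply, hψ x hx, smul_zero]

/-- Extension of a test function on `D` by zero, as a test function on the plane. -/
def extendByZero : 𝓓(D, ℝ) →L[ℝ] 𝓓((⊤ : TopologicalSpace.Opens Plane), ℝ) :=
  TestFunction.monoCLM ℝ

theorem coe_extendByZero (ψ : 𝓓(D, ℝ)) : ⇑(extendByZero ψ) = ψ := by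
  rw [extendByZero, TestFunction.monoCLM_apply, if_pos ⟨le_rfl, le_top⟩]

theorem coe_testGradient_extendByZero (ψ : 𝓓(D, ℝ)) :
    ⇑(testGradient (extendByZero ψ)) = testGradient ψ := by
  rw [coe_testGradient, coe_testGradient, coe_extendByZero]

theorem extendByZero_mem_flatOff (ψ : 𝓓(D, ℝ)) : extendByZero ψ ∈ flatOff D := fun x hx => by
  rw [coe_testGradient_extendByZero]
  exact image_eq_zero_of_notMem_tsupport fun h => hx ((testGradient ψ).tsupport_subset h)

theorem jet_extendByZero {A : TopologicalSpace.Opens Plane} (ψ : 𝓓(D, ℝ)) :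
    jet A (extendByZero ψ) = jet A ψ :=
  congrArg (WithLp.toLp 2) (Prod.ext (toL2_congr (coe_extendByZero ψ))
    (toL2_congr (coe_testGradient_extendByZero ψ)))

theorem toL2_eq_zero_of_disjoint {A : TopologicalSpace.Opens Plane} (h : Disjoint A D)
    (ψ : 𝓓(D, ℝ)) : toL2 A ψ = 0 := by
  refine Lp.ext ((coeFn_toL2 ψ).trans (EventuallyEq.trans ?_ (Lp.coeFn_zero ℝ 2 (vol A)).symm))
  filter_upwards [ae_restrict_mem A.isOpen.measurableSet] with x hx
  exact image_eq_zero_of_notMem_tsupport fun hx' =>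
    Set.disjoint_left.1 (TopologicalSpace.Opens.coe_disjoint.2 h) hx (ψ.tsupport_subset hx')

theorem enorm_toL2 {Ω : TopologicalSpace.Opens Plane} {F : Type*} [NormedAddCommGroup F]
    [NormedSpace ℝ F] (Φ : 𝓓(Ω, F)) : ‖toL2 D Φ‖ₑ = eLpNorm Φ 2 (vol D) :=
  Lp.enorm_toLp (memLp_testFunction Φ 2 _)

theorem exists_norm_toL2_le_of_mem_flatOff (hD : volume (D : Set Plane) ≠ ⊤) :
    ∃ C : ℝ, ∀ (A : TopologicalSpace.Opens Plane), ∀ ψ ∈ flatOff D,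
      ‖toL2 A ψ‖ ≤ C * ‖toL2 D (testGradient ψ)‖ := by
  have conjugate : NNReal.HolderConjugate (Module.finrank ℝ Plane) 2 := by
    rw [finrank_euclideanSpace_fin]
    exact_mod_cast NNReal.HolderConjugate.two_two
  let K : NNReal := eLpNormLESNormFDerivOneConst (volume : Measure Plane) 2
  let m : ℝ≥0∞ := volume (D : Set Plane) ^ (1 / 2 : ℝ)
  have m_ne_top : m ≠ ⊤ := ENNReal.rpow_ne_top_of_nonneg (by norm_num) hD
  refine ⟨(K * m).toReal, fun A ψ hψ => ?_⟩
  have gagliardo_nirenberg_sobolev : eLpNorm ψ 2 volume ≤ K * eLpNorm (fderiv ℝ ψ) 1 volume :=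
    eLpNorm_le_eLpNorm_fderiv_one volume (ψ.contDiff.of_le (by norm_cast)) ψ.hasCompactSupport
      conjugate
  have gradient_norm : eLpNorm (fderiv ℝ ψ) 1 volume = eLpNorm (testGradient ψ) 1 volume :=
    eLpNorm_congr_norm_ae (Eventually.of_forall fun x => by
      rw [coe_testGradient, gradient, LinearIsometryEquiv.norm_map])
  have gradient_off : eLpNorm (testGradient ψ) 1 volume = eLpNorm (testGradient ψ) 1 (vol D) :=
    (eLpNorm_restrict_eq_of_support_subset
      (Function.support_subset_iff'.2 fun x hx => hψ x hx)).symm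
  have cauchy_schwarz : eLpNorm (testGradient ψ) 1 (vol D) ≤
      eLpNorm (testGradient ψ) 2 (vol D) * m := by
    refine (eLpNorm_le_eLpNorm_mul_rpow_measure_univ (p := 1) (q := 2) (by norm_num)
      (testGradient ψ).continuous.aestronglyMeasurable).trans_eq ?_
    rw [Measure.restrict_apply_univ]
    norm_num [m]
  have enorm_le : ‖toL2 A ψ‖ₑ ≤ K * m * ‖toL2 D (testGradient ψ)‖ₑ := calc
    ‖toL2 A ψ‖ₑ ≤ eLpNorm ψ 2 volume := by
        rw [enorm_toL2]
        exact eLpNorm_mono_measure _ Measure.restrict_le_self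
    _ ≤ K * (eLpNorm (testGradient ψ) 2 (vol D) * m) := by
        refine gagliardo_nirenberg_sobolev.trans ?_
        rw [gradient_norm, gradient_off]
        gcongr
    _ = K * m * ‖toL2 D (testGradient ψ)‖ₑ := by rw [enorm_toL2]; ring
  simpa only [ENNReal.toReal_mul, toReal_enorm] using ENNReal.toReal_mono
    (ENNReal.mul_ne_top (ENNReal.mul_ne_top ENNReal.coe_ne_top m_ne_top) enorm_ne_top) enorm_le

theorem hasPoincare_sobolevZero (hD : volume (D : Set Plane) ≠ ⊤) :
    HasPoincare (sobolevZero D) := by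
  obtain ⟨C, hC⟩ := exists_norm_toL2_le_of_mem_flatOff hD
  have closed : IsClosed {z : WithLp 2 (L2 D × L2Vec D) | ‖z.fst‖ ≤ C * ‖z.snd‖} :=
    isClosed_le (WithLp.fstL 2 ℝ _ _).continuous.norm
      (continuous_const.mul (WithLp.sndL 2 ℝ _ _).continuous.norm)
  refine ⟨C, fun z hz => sobolevZero_subset closed (fun ψ => ?_) hz⟩
  rw [← jet_extendByZero]
  exact hC D _ (extendByZero_mem_flatOff ψ)

/-- Adding an element of `H¹₀(D)` to a function that is flat off `D` does not change its values off
`D`, so these are controlled by the gradient of the sum. -/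
theorem exists_norm_toL2_le_of_disjoint (hD : volume (D : Set Plane) ≠ ⊤) :
    ∃ C : ℝ, ∀ A : TopologicalSpace.Opens Plane, Disjoint A D → ∀ χ ∈ flatOff D,
      ∀ z ∈ sobolevZero D, ‖toL2 A χ‖ ≤ C * ‖z.snd + toL2 D (testGradient χ)‖ := by
  obtain ⟨C, hC⟩ := exists_norm_toL2_le_of_mem_flatOff hD
  refine ⟨C, fun A hA χ hχ z hz => ?_⟩
  have closed : IsClosed {z : WithLp 2 (L2 D × L2Vec D) |
      ‖toL2 A χ‖ ≤ C * ‖z.snd + toL2 D (testGradient χ)‖} :=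
    isClosed_le continuous_const
      (continuous_const.mul ((WithLp.sndL 2 ℝ _ _).continuous.add continuous_const).norm)
  refine sobolevZero_subset closed (fun ψ => ?_) hz
  have extension_off : toL2 A (extendByZero ψ) = 0 :=
    (toL2_congr (coe_extendByZero ψ)).trans (toL2_eq_zero_of_disjoint hA ψ)
  have bound := hC A _ (add_mem (extendByZero_mem_flatOff ψ) hχ)
  rw [map_add, map_add, map_add, extension_off, zero_add] at bound
  rwa [← jet_extendByZero]

theorem isSolutionOperator_green (hD : volume (D : Set Plane) ≠ ⊤) :
    IsSolutionOperator (sobolevZero D) (green D) := fun φ => by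
  have green_spec : green D φ ∈ H10 D ∧ HasWeakLaplacian D (green D φ) (-φ) := by
    refine Classical.epsilon_spec (p := fun w => w ∈ H10 D ∧ HasWeakLaplacian D w (-φ)) ?_
    obtain ⟨s, hs, weak⟩ :=
      (hasPoincare_sobolevZero hD).exists_inner_snd_eq (WithLp.toLp 2 (φ, 0))
    have gradient := mem_weakGradientGraph.1 (sobolevZero_le_weakGradientGraph hs)
    refine ⟨s.fst, mem_H10_iff.2 ⟨s, hs, rfl⟩, gradient.hasWeakLaplacian_iff_sobolevZero.2 ?_⟩
    intro z hz
    rw [weak z hz, WithLp.prod_inner_apply, neg_neg, inner_zero_left, add_zero]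
    rfl
  obtain ⟨s, hs, hsφ⟩ := mem_H10_iff.1 green_spec.1
  have gradient := mem_weakGradientGraph.1 (sobolevZero_le_weakGradientGraph hs)
  have weak := gradient.hasWeakLaplacian_iff_sobolevZero.1 (hsφ ▸ green_spec.2)
  exact ⟨s, ⟨hs, fun z hz => (weak z hz).trans (by rw [neg_neg])⟩, hsφ⟩

theorem hasWeakGradient_add_jet {Ω : TopologicalSpace.Opens Plane}
    {z : WithLp 2 (L2 D × L2Vec D)} (hz : z ∈ sobolevZero D) (Ψ : 𝓓(Ω, ℝ)) :
    HasWeakGradient D (z + jet D Ψ).fst (z + jet D Ψ).snd :=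
  mem_weakGradientGraph.1
    (add_mem (sobolevZero_le_weakGradientGraph hz) (jet_mem_weakGradientGraph Ψ))

theorem exists_hasWeakLaplacian_add_jet_zero {Ω : TopologicalSpace.Opens Plane}
    (hD : volume (D : Set Plane) ≠ ⊤) (Ψ : 𝓓(Ω, ℝ)) :
    ∃ z ∈ sobolevZero D, HasWeakLaplacian D (z + jet D Ψ).fst 0 := by
  obtain ⟨z, hz, weak⟩ :=
    (hasPoincare_sobolevZero hD).exists_inner_snd_eq (WithLp.toLp 2 (0, -(jet D Ψ).snd))
  refine ⟨z, hz, (hasWeakGradient_add_jet hz Ψ).hasWeakLaplacian_iff_sobolevZero.2 ?_⟩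
  intro w hw
  rw [WithLp.add_snd, inner_add_left, weak w hw, WithLp.prod_inner_apply]
  simp

theorem exists_mem_sobolevZero_fst_ne_zero (hne : (D : Set Plane).Nonempty) :
    ∃ z ∈ sobolevZero D, z.fst ≠ 0 := by
  obtain ⟨x, hx⟩ := hne
  obtain ⟨f, hfD, hfc, hf, -, hfx⟩ :=
    exists_contDiff_tsupport_subset (n := ⊤) (D.isOpen.mem_nhds hx)
  let ψ : 𝓓(D, ℝ) := ⟨f, hf, hfc, hfD⟩
  refine ⟨jet D ψ, jet_mem_sobolevZero ψ, fun h => one_ne_zero (α := ℝ) ?_⟩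
  rw [← hfx]
  exact eqOn_zero_of_toL2_eq_zero (ψ := ψ) h hx

end Poincare

section AugmentedSpace

variable {D : TopologicalSpace.Opens Plane} {ι : Type*}

/-- The matrix `∫_D ∇ζᵢ · ∇ζⱼ`. -/
def gradientGram (ζ : ι → L2 D) : Matrix ι ι ℝ := Matrix.of fun i j =>
  ∫ x, inner ℝ (weakGradient D (ζ i) x) (weakGradient D (ζ j) x) ∂(vol D)

/-- The pairs `(u, ∇u)`, `u ∈ augmentedSpace ζ`. -/
def augmentedGraph (ζ : ι → L2 D) : Submodule ℝ (WithLp 2 (L2 D × L2Vec D)) :=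
  sobolevZero D ⊔ .span ℝ (Set.range fun i => WithLp.toLp 2 (ζ i, weakGradient D (ζ i)))

variable {ζ : ι → L2 D}

theorem hasWeakGradient_weakGradient {u : L2 D} (hu : u ∈ H1 D) :
    HasWeakGradient D u (weakGradient D u) :=
  Classical.epsilon_spec hu

theorem inner_weakGradient_eq_zero {u : L2 D} (hu : u ∈ H1 D) (harm : HasWeakLaplacian D u 0)
    {z : WithLp 2 (L2 D × L2Vec D)} (hz : z ∈ sobolevZero D) :
    inner ℝ (weakGradient D u) z.snd = 0 := by
  rw [(hasWeakGradient_weakGradient hu).hasWeakLaplacian_iff_sobolevZero.1 harm z hz, neg_zero,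
    inner_zero_left]

theorem augmentedGraph_le_weakGradientGraph (hζ : ∀ i, ζ i ∈ H1 D) :
    augmentedGraph ζ ≤ weakGradientGraph D := by
  refine sup_le sobolevZero_le_weakGradientGraph (Submodule.span_le.2 ?_)
  rintro _ ⟨i, rfl⟩
  exact mem_weakGradientGraph.2 (hasWeakGradient_weakGradient (hζ i))

theorem dirichletEnergy_fst (hζ : ∀ i, ζ i ∈ H1 D) {z : WithLp 2 (L2 D × L2Vec D)}
    (hz : z ∈ augmentedGraph ζ) : dirichletEnergy D z.fst = ‖z.snd‖ ^ 2 := by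
  rw [dirichletEnergy_eq_norm_sq,
    (mem_weakGradientGraph.1 (augmentedGraph_le_weakGradientGraph hζ hz)).weakGradient_eq]

theorem IsWeakSolution.hasWeakLaplacian (hζ : ∀ i, ζ i ∈ H1 D) {φ : L2 D}
    {s : WithLp 2 (L2 D × L2Vec D)} (hs : IsWeakSolution (augmentedGraph ζ) φ s) :
    HasWeakLaplacian D s.fst (-φ) := by
  have gradient := mem_weakGradientGraph.1 (augmentedGraph_le_weakGradientGraph hζ hs.1)
  refine gradient.hasWeakLaplacian_iff_sobolevZero.2 fun z hz => ?_
  rw [neg_neg, hs.2 z (Submodule.mem_sup_left hz)]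

theorem hasPoincare_augmentedGraph [Finite ι] (hD : volume (D : Set Plane) ≠ ⊤)
    (hζ : ∀ i, ζ i ∈ H1 D) (harm : ∀ i, HasWeakLaplacian D (ζ i) 0)
    (hind : LinearIndependent ℝ fun i => weakGradient D (ζ i)) :
    HasPoincare (augmentedGraph ζ) := by
  refine (hasPoincare_sobolevZero hD).sup (hasPoincare_span_range hind) fun x hx y hy => ?_
  have le : Submodule.span ℝ (Set.range fun i => WithLp.toLp 2 (ζ i, weakGradient D (ζ i))) ≤
      (ℝ ∙ WithLp.toLp 2 (-0, x.snd))ᗮ := by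
    refine Submodule.span_le.2 ?_
    rintro _ ⟨i, rfl⟩
    refine inner_snd_eq_iff_mem_orthogonal.1 ?_
    rw [inner_zero_left, real_inner_comm]
    exact inner_weakGradient_eq_zero (hζ i) (harm i) hx
  rw [inner_snd_eq_iff_mem_orthogonal.2 (le hy), inner_zero_left]

variable [Fintype ι]

/-- The space of all `u ∈ H¹(D)` of the form `u = v + ∑ᵢ θᵢ ζᵢ`, `v ∈ H¹₀(D)`, `θᵢ ∈ ℝ`; this is
`𝒳` for an arbitrary finite family `ζ`. -/
def augmentedSpace (ζ : ι → L2 D) : Set (L2 D) :=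
  {u | u ∈ H1 D ∧ ∃ v ∈ H10 D, ∃ θ : ι → ℝ, u = v + ∑ i, θ i • ζ i}

/-- The infimum `λ` of the Dirichlet energy over the normalized elements of `augmentedSpace ζ`. -/
def dirichletInf (ζ : ι → L2 D) : ℝ :=
  sInf {e | ∃ u ∈ augmentedSpace ζ, ‖u‖ = 1 ∧ e = dirichletEnergy D u}

/-- `u` is a minimizer for `dirichletInf ζ`. -/
def IsDirichletMinimizer (ζ : ι → L2 D) (u : L2 D) : Prop :=
  u ∈ augmentedSpace ζ ∧ ‖u‖ = 1 ∧ dirichletEnergy D u = dirichletInf ζ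

/-- The operator `𝒫` for an arbitrary finite family `ζ`, with `q` the inverse of
`gradientGram ζ`. -/
def augmentedGreen [DecidableEq ι] (ζ : ι → L2 D) (φ : L2 D) : L2 D :=
  green D φ +
    ∑ i, ∑ j, ((gradientGram ζ)⁻¹ i j * ∫ x, ζ i x * φ x ∂(vol D)) • ζ j

theorem mem_augmentedSpace_iff (hζ : ∀ i, ζ i ∈ H1 D) {u : L2 D} :
    u ∈ augmentedSpace ζ ↔ ∃ z ∈ augmentedGraph ζ, z.fst = u := by
  have fst_combination (v : WithLp 2 (L2 D × L2Vec D)) (θ : ι → ℝ) :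
      (v + ∑ i, θ i • WithLp.toLp 2 (ζ i, weakGradient D (ζ i))).fst =
        v.fst + ∑ i, θ i • ζ i := by
    rw [← WithLp.fstₗ_apply (𝕜 := ℝ)]
    simp only [map_add, map_sum, map_smul, WithLp.fstₗ_apply, WithLp.toLp_fst]
  constructor
  · rintro ⟨-, v, hv, θ, rfl⟩
    obtain ⟨z, hz, rfl⟩ := mem_H10_iff.1 hv
    exact ⟨_, Submodule.add_mem_sup hz
      ((Submodule.mem_span_range_iff_exists_fun ℝ).2 ⟨θ, rfl⟩), fst_combination z θ⟩
  · rintro ⟨z, hz, rfl⟩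
    refine ⟨⟨z.snd, mem_weakGradientGraph.1 (augmentedGraph_le_weakGradientGraph hζ hz)⟩, ?_⟩
    obtain ⟨v, hv, w, hw, rfl⟩ := Submodule.mem_sup.1 hz
    obtain ⟨θ, rfl⟩ := (Submodule.mem_span_range_iff_exists_fun ℝ).1 hw
    exact ⟨v.fst, mem_H10_iff.2 ⟨v, hv, rfl⟩, θ, fst_combination v θ⟩

theorem dirichletInf_eq_rayleighInf (hζ : ∀ i, ζ i ∈ H1 D) :
    dirichletInf ζ = rayleighInf (augmentedGraph ζ) := by
  refine congrArg sInf (Set.ext fun e => ?_)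
  constructor
  · rintro ⟨u, hu, h1, rfl⟩
    obtain ⟨z, hz, rfl⟩ := (mem_augmentedSpace_iff hζ).1 hu
    exact ⟨z, hz, h1, dirichletEnergy_fst hζ hz⟩
  · rintro ⟨z, hz, h1, rfl⟩
    exact ⟨z.fst, (mem_augmentedSpace_iff hζ).2 ⟨z, hz, rfl⟩, h1, (dirichletEnergy_fst hζ hz).symm⟩

theorem isDirichletMinimizer_iff (hζ : ∀ i, ζ i ∈ H1 D) {u : L2 D} :
    IsDirichletMinimizer ζ u ↔ ∃ z, IsRayleighMinimizer (augmentedGraph ζ) z ∧ z.fst = u := by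
  rw [IsDirichletMinimizer, dirichletInf_eq_rayleighInf hζ]
  constructor
  · rintro ⟨hu, h1, hmin⟩
    obtain ⟨z, hz, rfl⟩ := (mem_augmentedSpace_iff hζ).1 hu
    exact ⟨z, ⟨hz, h1, dirichletEnergy_fst hζ hz ▸ hmin⟩, rfl⟩
  · rintro ⟨z, ⟨hz, h1, hmin⟩, rfl⟩
    exact ⟨(mem_augmentedSpace_iff hζ).2 ⟨z, hz, rfl⟩, h1, (dirichletEnergy_fst hζ hz).trans hmin⟩

theorem isSolutionOperator_augmentedGreen [DecidableEq ι] (hD : volume (D : Set Plane) ≠ ⊤)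
    (hζ : ∀ i, ζ i ∈ H1 D) (harm : ∀ i, HasWeakLaplacian D (ζ i) 0)
    (hind : LinearIndependent ℝ fun i => weakGradient D (ζ i)) :
    IsSolutionOperator (augmentedGraph ζ) (augmentedGreen ζ) := fun φ => by
  obtain ⟨s, hs, hsφ⟩ := isSolutionOperator_green hD φ
  refine ⟨_, hs.add_sum_gram_inv_smul (ζ := fun i => WithLp.toLp 2 (ζ i, weakGradient D (ζ i))) hind
    fun z hz i => inner_weakGradient_eq_zero (hζ i) (harm i) hz, ?_⟩
  have gram_eq : (Matrix.gram ℝ fun i => weakGradient D (ζ i)) = gradientGram ζ :=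
    Matrix.ext fun i j => L2.inner_def _ _
  have pairing (i : ι) : inner ℝ φ (ζ i) = ∫ x, ζ i x * φ x ∂(vol D) := by
    simp only [L2.inner_def, Real.inner_apply, mul_comm]
  rw [augmentedGreen, ← hsφ, ← gram_eq, ← WithLp.fstₗ_apply (𝕜 := ℝ)]
  simp only [map_add, map_sum, map_smul, WithLp.fstₗ_apply, WithLp.toLp_fst,
    WithLp.toLp_snd, pairing]

end AugmentedSpace

section Extension

theorem eventually_mem_or_of_eventually_nhdsSet_frontier {X : Type*} [TopologicalSpace X]
    {K : Set X} (hK : IsClosed K) {p : X → Prop} (h : ∀ᶠ x in 𝓝ˢ (frontier K), p x) :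
    ∀ᶠ x in 𝓝ˢ K, x ∈ K ∨ p x := by
  refine eventually_nhdsSet_iff_forall.2 fun x hx => ?_
  rw [← hK.closure_eq, closure_eq_interior_union_frontier] at hx
  rcases hx with hx | hx
  · exact mem_of_superset (mem_interior_iff_mem_nhds.1 hx) fun _ => Or.inl
  · exact (eventually_nhdsSet_iff_forall.1 h x hx).mono fun _ => Or.inr

variable {E κ : Type*} [NormedAddCommGroup E] [NormedSpace ℝ E] {K : κ → Set E}
  [Finite κ] (hK : ∀ k, IsClosed (K k)) (hd : Pairwise (Function.onFun Disjoint K))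
include hK hd

theorem exists_contDiff_eventually_eq_ite [FiniteDimensional ℝ E] [DecidableEq κ] (i : κ) :
    ∃ χ : E → ℝ, ContDiff ℝ ∞ χ ∧ ∀ k, ∀ᶠ x in 𝓝ˢ (K k), χ x = if k = i then 1 else 0 := by
  have disjoint : Disjoint (⋃ k : {k // k ≠ i}, K k) (K i) :=
    Set.disjoint_iUnion_left.2 fun k => hd k.2
  obtain ⟨χ, h0, h1, -⟩ := exists_contMDiffMap_zero_one_nhds_of_isClosed
    (modelWithCornersSelf ℝ E) (n := ⊤) (isClosed_iUnion_of_finite fun k : {k // k ≠ i} => hK k)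
    (hK i) disjoint
  refine ⟨χ, χ.contMDiff.contDiff, fun k => ?_⟩
  rcases eq_or_ne k i with rfl | hk
  · simpa only [if_true] using h1
  · simp only [hk, if_false]
    exact h0.filter_mono (nhdsSet_mono (Set.subset_iUnion (fun k : {k // k ≠ i} => K k) ⟨k, hk⟩))

theorem exists_contDiff_eq_off_eventually_const {F : Type*} [NormedAddCommGroup F]
    [NormedSpace ℝ F] {χ : E → F} (hχ : ContDiff ℝ ∞ χ) {c : κ → F}
    (h : ∀ k, ∀ᶠ x in 𝓝ˢ (frontier (K k)), χ x = c k) :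
    ∃ f : E → F, ContDiff ℝ ∞ f ∧ (∀ x, (∀ k, x ∉ K k) → f x = χ x) ∧
      ∀ k, ∀ᶠ x in 𝓝ˢ (K k), f x = c k := by
  classical
  let f : E → F := fun x => if hx : ∃ k, x ∈ K k then c hx.choose else χ x
  have f_off (x : E) (hx : ∀ k, x ∉ K k) : f x = χ x := dif_neg (not_exists.2 hx)
  have f_on (k : κ) (x : E) (hx : x ∈ K k) : f x = c k := by
    have hex : ∃ k, x ∈ K k := ⟨k, hx⟩
    have choose_eq : hex.choose = k :=
      hd.eq (Set.not_disjoint_iff.2 ⟨x, hex.choose_spec, hx⟩)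
    rw [← choose_eq]
    exact dif_pos hex
  have f_near (k : κ) : ∀ᶠ x in 𝓝ˢ (K k), f x = c k := by
    have off_others : ∀ᶠ x in 𝓝ˢ (K k), ∀ l ≠ k, x ∉ K l :=
      eventually_all.2 fun l => eventually_imp_distrib_left.2 fun hl =>
        (hK l).isOpen_compl.mem_nhdsSet.2 (hd hl).subset_compl_left
    filter_upwards [eventually_mem_or_of_eventually_nhdsSet_frontier (hK k) (h k), off_others]
      with x hx hx'
    by_cases hxk : x ∈ K k
    · exact f_on k x hxk
    · rw [f_off x fun l => if hl : l = k then hl ▸ hxk else hx' l hl, hx.resolve_left hxk]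
  refine ⟨f, contDiff_iff_contDiffAt.2 fun x => ?_, f_off, f_near⟩
  by_cases hx : ∃ k, x ∈ K k
  · obtain ⟨k, hk⟩ := hx
    exact contDiffAt_const.congr_of_eventuallyEq (eventually_nhdsSet_iff_forall.1 (f_near k) x hk)
  · have open_off : IsOpen (⋃ k, K k)ᶜ := (isClosed_iUnion_of_finite hK).isOpen_compl
    refine hχ.contDiffAt.congr_of_eventuallyEq ?_
    filter_upwards [open_off.mem_nhds (mt Set.mem_iUnion.1 hx)] with y hy
    exact f_off y (not_exists.1 (mt Set.mem_iUnion.2 hy))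

end Extension

namespace MultiplyConnected

variable {N : ℕ} (M : MultiplyConnected N)

theorem volume_domain_ne_top : volume (M.domain : Set Plane) ≠ ⊤ :=
  (M.outer_smooth.isBounded.subset Set.sdiff_subset).measure_lt_top.ne

theorem domain_nonempty : (M.domain : Set Plane).Nonempty := by
  refine Set.nonempty_iff_ne_empty.2 fun empty => ?_
  have outer_eq : M.outer = ⋃ i, closure (M.hole i) :=
    (Set.sdiff_eq_empty.1 empty).antisymm (Set.iUnion_subset M.hole_subset)
  have closed : IsClosed M.outer :=
    outer_eq ▸ isClosed_iUnion_of_finite fun _ => isClosed_closure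
  have outer_eq_univ := IsClopen.eq_univ ⟨closed, M.outer_smooth.isOpen⟩
    M.outer_smooth.simplyConnected.nonempty
  exact NormedSpace.unbounded_univ ℝ Plane (outer_eq_univ ▸ M.outer_smooth.isBounded)

/-- The closed pieces into which the complement of the domain decomposes: the complement of `outer`,
with index `none`, and the closed holes. -/
def obstacle : Option (Fin N) → Set Plane
  | none => M.outerᶜ
  | some j => closure (M.hole j)

theorem isClosed_obstacle : ∀ k, IsClosed (M.obstacle k)
  | none => M.outer_smooth.isOpen.isClosed_compl
  | some _ => isClosed_closure

theorem pairwise_disjoint_obstacle : Pairwise (Function.onFun Disjoint M.obstacle)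
  | none, none, h => absurd rfl h
  | none, some j, _ => Set.disjoint_compl_left_iff_subset.2 (M.hole_subset j)
  | some i, none, _ => Set.disjoint_compl_right_iff_subset.2 (M.hole_subset i)
  | some i, some j, h => M.hole_disjoint i j fun hij => h (congrArg some hij)

theorem mem_domain_iff {x : Plane} : x ∈ M.domain ↔ ∀ k, x ∉ M.obstacle k := by
  change x ∈ M.outer \ ⋃ i, closure (M.hole i) ↔ _
  simp only [Set.mem_sdiff, Set.mem_iUnion, not_exists, Option.forall, obstacle,
    Set.mem_compl_iff, not_not]

theorem disjoint_hole_domain (j : Fin N) :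
    Disjoint ⟨M.hole j, (M.hole_smooth j).isOpen⟩ M.domain :=
  TopologicalSpace.Opens.coe_disjoint.1 <| Set.disjoint_left.2 fun _ hx hxD =>
    M.mem_domain_iff.1 hxD (some j) (subset_closure hx)

theorem exists_cutoff (i : Fin N) : ∃ χ : Plane → ℝ, ContDiff ℝ ∞ χ ∧
    (∀ᶠ x in 𝓝ˢ (frontier M.outer), χ x = 0) ∧
    (∀ j, ∀ᶠ x in 𝓝ˢ (frontier (M.hole j)), χ x = if j = i then 1 else 0) := by
  obtain ⟨χ, hχ, h⟩ := exists_contDiff_eventually_eq_ite M.isClosed_obstacle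
    M.pairwise_disjoint_obstacle (some i)
  refine ⟨χ, hχ, ?_, fun j => ?_⟩
  · refine (h none).filter_mono (nhdsSet_mono ?_)
    exact M.outer_smooth.isOpen.frontier_eq ▸ fun x hx => hx.2
  · simpa only [Option.some_inj] using
      (h (some j)).filter_mono (nhdsSet_mono frontier_subset_closure)

theorem exists_flatOff_extension {i : Fin N} {χ : Plane → ℝ} (hχ : ContDiff ℝ ∞ χ)
    (h0 : ∀ᶠ x in 𝓝ˢ (frontier M.outer), χ x = 0)
    (h1 : ∀ j, ∀ᶠ x in 𝓝ˢ (frontier (M.hole j)), χ x = if j = i then 1 else 0) :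
    ∃ Ψ ∈ flatOff M.domain, Set.EqOn Ψ χ M.domain ∧
      ∀ j, ∀ x ∈ M.hole j, Ψ x = if j = i then 1 else 0 := by
  have boundary_values (k) : ∀ᶠ x in 𝓝ˢ (frontier (M.obstacle k)),
      χ x = k.elim 0 fun j => if j = i then 1 else 0 := by
    cases k with
    | none => rwa [obstacle, frontier_compl]
    | some j => exact (h1 j).filter_mono (nhdsSet_mono frontier_closure_subset)
  obtain ⟨f, hf, f_domain, f_obstacle⟩ := exists_contDiff_eq_off_eventually_const
    M.isClosed_obstacle M.pairwise_disjoint_obstacle hχ boundary_values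
  have compact : HasCompactSupport f :=
    .intro M.outer_smooth.isBounded.isCompact_closure fun x hx =>
      (f_obstacle none).self_of_nhdsSet x fun hx' => hx (subset_closure hx')
  let Ψ : 𝓓((⊤ : TopologicalSpace.Opens Plane), ℝ) := ⟨f, hf, compact, Set.subset_univ _⟩
  refine ⟨Ψ, fun x hx => ?_, fun x hx => f_domain x (M.mem_domain_iff.1 hx), fun j x hx =>
    (f_obstacle (some j)).self_of_nhdsSet x (subset_closure hx)⟩
  obtain ⟨k, hk⟩ : ∃ k, x ∈ M.obstacle k := by
    simpa only [not_forall, not_not] using mt M.mem_domain_iff.2 hx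
  have locally_const : f =ᶠ[𝓝 x] fun _ => k.elim 0 fun j => if j = i then 1 else 0 :=
    eventually_nhdsSet_iff_forall.1 (f_obstacle k) x hk
  rw [coe_testGradient]
  exact locally_const.gradient_eq.trans (gradient_const x _)

theorem isHarmonicPotential_zeta (i : Fin N) : M.IsHarmonicPotential i (M.zeta i) := by
  refine Classical.epsilon_spec (p := M.IsHarmonicPotential i) ?_
  obtain ⟨χ, hχ, h0, h1⟩ := M.exists_cutoff i
  obtain ⟨Ψ, -, hΨχ, -⟩ := M.exists_flatOff_extension hχ h0 h1
  obtain ⟨z, hz, harmonic⟩ := exists_hasWeakLaplacian_add_jet_zero M.volume_domain_ne_top Ψ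
  refine ⟨_, ⟨_, hasWeakGradient_add_jet hz Ψ⟩, harmonic, χ, hχ, h0, h1, z.fst,
    mem_H10_iff.2 ⟨z, hz, rfl⟩, ?_⟩
  filter_upwards [Lp.coeFn_add z.fst (toL2 M.domain Ψ), coeFn_toL2 Ψ,
    ae_restrict_mem M.domain.isOpen.measurableSet] with x hadd hΨ hx
  exact hadd.trans (congrArg (z.fst x + ·) (hΨ.trans (hΨχ hx)))

theorem zeta_mem_H1 (i : Fin N) : M.zeta i ∈ H1 M.domain := (M.isHarmonicPotential_zeta i).1

theorem hasWeakLaplacian_zeta (i : Fin N) : HasWeakLaplacian M.domain (M.zeta i) 0 :=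
  (M.isHarmonicPotential_zeta i).2.1

theorem exists_zeta_eq_fst_add_jet (i : Fin N) :
    ∃ Ψ ∈ flatOff M.domain, (∀ j, ∀ x ∈ M.hole j, Ψ x = if j = i then 1 else 0) ∧
      ∃ z ∈ sobolevZero M.domain, M.zeta i = (z + jet M.domain Ψ).fst := by
  obtain ⟨-, -, χ, hχ, h0, h1, v, hv, zeta_eq⟩ := M.isHarmonicPotential_zeta i
  obtain ⟨Ψ, hΨ, hΨχ, hΨj⟩ := M.exists_flatOff_extension hχ h0 h1
  obtain ⟨z, hz, rfl⟩ := mem_H10_iff.1 hv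
  refine ⟨Ψ, hΨ, hΨj, z, hz, Lp.ext ?_⟩
  filter_upwards [zeta_eq, Lp.coeFn_add z.fst (toL2 M.domain Ψ), coeFn_toL2 Ψ,
    ae_restrict_mem M.domain.isOpen.measurableSet] with x hζ hadd hΨx hx
  exact hζ.trans (hadd.trans (congrArg (z.fst x + ·) (hΨx.trans (hΨχ hx)))).symm

/-- The extension to the plane of a combination of the `ζᵢ` takes the coefficients as values on the
holes, and it vanishes there if its gradient on the domain is zero. -/
theorem linearIndependent_weakGradient_zeta :
    LinearIndependent ℝ fun i => weakGradient M.domain (M.zeta i) := by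
  choose Ψ hΨ hΨj z hz zeta_eq using M.exists_zeta_eq_fst_add_jet
  have weakGradient_zeta (i) : weakGradient M.domain (M.zeta i) = (z i + jet M.domain (Ψ i)).snd :=
    zeta_eq i ▸ (hasWeakGradient_add_jet (hz i) (Ψ i)).weakGradient_eq
  simp only [weakGradient_zeta]
  refine Fintype.linearIndependent_iff.2 fun θ hθ j => ?_
  let χ := ∑ i, θ i • Ψ i
  let w := ∑ i, θ i • z i
  have gradient_eq_zero : w.snd + toL2 M.domain (testGradient χ) = 0 := by
    have combination_eq : w + jet M.domain χ = ∑ i, θ i • (z i + jet M.domain (Ψ i)) := by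
      simp only [w, χ, map_sum, map_smul, smul_add, Finset.sum_add_distrib]
    refine (congrArg WithLp.snd combination_eq).trans (Eq.trans ?_ hθ)
    rw [← WithLp.sndₗ_apply (𝕜 := ℝ)]
    simp only [map_sum, map_smul, WithLp.sndₗ_apply]
  obtain ⟨C, hC⟩ := exists_norm_toL2_le_of_disjoint M.volume_domain_ne_top
  have bound := hC _ (M.disjoint_hole_domain j) χ
    (sum_mem fun i _ => Submodule.smul_mem _ _ (hΨ i)) w
    (sum_mem fun i _ => Submodule.smul_mem _ _ (hz i))
  rw [gradient_eq_zero, norm_zero, mul_zero, norm_le_zero_iff] at bound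
  obtain ⟨x, hx⟩ := (M.hole_smooth j).simplyConnected.nonempty
  have value : χ x = θ j := by
    simp only [χ, sum_apply, smul_apply, hΨj _ j x hx, smul_eq_mul, mul_ite, mul_one, mul_zero,
      Finset.sum_ite_eq, Finset.mem_univ, if_true]
  exact value.symm.trans (eqOn_zero_of_toL2_eq_zero bound hx)

theorem formP_eq_inner (φ : L2 M.domain) :
    M.formP φ = inner ℝ (augmentedGreen M.zeta φ) φ := by
  simp only [formP, L2.inner_def, Real.inner_apply, mul_comm]
  rfl

theorem Lam_eq_formSup : M.Lam = formSup (augmentedGreen M.zeta) := by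
  simp only [Lam, formSup, formP_eq_inner]

theorem isMaximizer_iff {φ : L2 M.domain} :
    M.IsMaximizer φ ↔ IsFormMaximizer (augmentedGreen M.zeta) φ := by
  rw [IsMaximizer, IsFormMaximizer, formP_eq_inner, Lam_eq_formSup]

end MultiplyConnected

end HoledDomain

end

open HoledDomain in
theorem proposition3p4_general {D : TopologicalSpace.Opens Plane}
    (hD : volume (D : Set Plane) ≠ ⊤) (hne : (D : Set Plane).Nonempty)
    {ι : Type*} [Fintype ι] [DecidableEq ι] {ζ : ι → L2 D} (hζ : ∀ i, ζ i ∈ H1 D)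
    (harm : ∀ i, HasWeakLaplacian D (ζ i) 0)
    (hind : LinearIndependent ℝ fun i => weakGradient D (ζ i)) :
    dirichletInf ζ * formSup (augmentedGreen ζ) = 1 ∧
    (∀ φ, IsFormMaximizer (augmentedGreen ζ) φ →
      IsDirichletMinimizer ζ ((formSup (augmentedGreen ζ))⁻¹ • augmentedGreen ζ φ)) ∧
    (∀ u, IsDirichletMinimizer ζ u → ∃ f, HasWeakLaplacian D u f ∧
      IsFormMaximizer (augmentedGreen ζ) ((dirichletInf ζ)⁻¹ • (-f))) := by
  have solution := isSolutionOperator_augmentedGreen hD hζ harm hind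
  have nontrivial : ∃ z ∈ augmentedGraph ζ, z.fst ≠ 0 :=
    let ⟨z, hz, hz0⟩ := exists_mem_sobolevZero_fst_ne_zero hne
    ⟨z, Submodule.mem_sup_left hz, hz0⟩
  have positive := rayleighInf_pos (hasPoincare_augmentedGraph hD hζ harm hind) nontrivial
  have duality := solution.rayleighInf_mul_formSup positive nontrivial
  rw [dirichletInf_eq_rayleighInf hζ]
  refine ⟨duality, fun φ hφ => (isDirichletMinimizer_iff hζ).2
    (hφ.exists_isRayleighMinimizer positive solution duality), fun u hu => ?_⟩
  obtain ⟨z, hz, rfl⟩ := (isDirichletMinimizer_iff hζ).1 hu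
  refine ⟨_, (hz.isWeakSolution positive solution).hasWeakLaplacian hζ, ?_⟩
  rw [neg_neg, inv_smul_smul₀ positive.ne']
  exact hz.isFormMaximizer positive solution duality

theorem proposition3p4 {N : ℕ} (M : HoledDomain.MultiplyConnected N) :
    M.lam * M.Lam = 1 ∧
    (∀ φ : HoledDomain.L2 M.domain, M.IsMaximizer φ → M.IsMinimizer (M.Lam⁻¹ • M.opP φ)) ∧
    (∀ u : HoledDomain.L2 M.domain, M.IsMinimizer u →
      ∃ f : HoledDomain.L2 M.domain, HoledDomain.HasWeakLaplacian M.domain u f ∧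
        M.IsMaximizer (M.lam⁻¹ • (-f))) := by
  simp only [M.Lam_eq_formSup, M.isMaximizer_iff]
  exact proposition3p4_general M.volume_domain_ne_top M.domain_nonempty M.zeta_mem_H1
    M.hasWeakLaplacian_zeta M.linearIndependent_weakGradient_zeta
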